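/- Let $\mathbb K$ be a field and $m\ge 0$. For a monic monomial $g=u_1^{j_1}\cdots u_m^{j_m}\in\mathbb K[u_1,\dots,u_m]$ of degree $d=j_1+\dots+j_m$ let $\Delta_g$ be the (topological) $(d-1)$-dimensional simplex with vertex set $W_g=\{u_1^1,\dots,u_1^{j_1},\dots,u_m^1,\dots,u_m^{j_m}\}$ (so $\Delta_1=\emptyset$). Let $X_g$ be the quotient of $\Delta_g$ obtained by identifying any two faces of $\Delta_g$ that have, for every $k$, the same number of vertices among $u_k^1,\dots,u_k^{j_k}$, through the affine isomorphism that preserves, for every $k$, the order of these vertices. (Thus $X_{u_k^{j}}$ is a $(j-1)$-simplex in which, for every $\ell$, all the $\ell$-faces are identified to one, and $X_g$ is the join of the spaces $X_{u_1^{j_1}},\dots,X_{u_m^{j_m}}$.) If $c$ divides $g$, the inclusion $u_k^i\mapsto u_k^i$ of $W_c$ in $W_g$ induces a map $X_c\to X_g$. Let $P(m)$ be the quotient of $\bigsqcup_g X_g$, over all the monic monomials $g$, obtained by gluing $X_g$ and $X_{g'}$ along $X_c$ for all $g,g'$ and all common divisors $c$ of $g$ and $g'$. Then $P(m)$ is a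 (Hausdorff) CW-complex whose open $n$-cells are exactly the images in $P(m)$ of the open $n$-dimensional faces of the simplices $\Delta_g$, and each $X_g\to P(m)$ is a homeomorphism onto its image; we denote this image again by $X_g$. Moreover: (1) for every $d\ge1$, the map $g\mapsto X_g$ is a bijection from the set of the monic monomials of degree $d$ in $\mathbb K[u_1,\dots,u_m]$ onto the set of the elements of the $(d-1)$-skeleton of $P(m)$, i.e. the set of the closures of the $(d-1)$-cells of $P(m)$; (2) for all monic monomials $g,g'\in\mathbb K[u_1,\dots,u_m]$, $X_g\subset X_{g'}$ if and only if $g$ divides $g'$. -/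

import Mathlib

open Topology

noncomputable section

namespace MonomialCW

/-- Exponent vectors `s = (j_1, …, j_m)`; `s` stands for the monic monomial
`u_1 ^ j_1 ⋯ u_m ^ j_m`. -/
abbrev Exponent (m : ℕ) : Type := Fin m →₀ ℕ

/-- The vertex set `W = {u_1¹, …, u_1^{j_1}, …, u_m¹, …, u_m^{j_m}}` of the simplex attached to
`u_1 ^ j_1 ⋯ u_m ^ j_m`. -/
abbrev Vertex {m : ℕ} (s : Exponent m) : Type := (k : Fin m) × Fin (s k)

/-- The topological simplex with vertex set `W`. It has dimension `d - 1`, where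
`d = j_1 + ⋯ + j_m` (and it is empty for `d = 0`). -/
abbrev Simplex {m : ℕ} (s : Exponent m) : Type := stdSimplex ℝ (Vertex s)

/-- A choice, for every `k`, of `a k` of the `s k` vertices `u_k¹, …, u_k^{s k}` (in increasing
order), that is, a face of the simplex of `s` that has `a k` vertices of the `k`-th kind. -/
abbrev FaceChoice {m : ℕ} (a s : Exponent m) : Type := ∀ k, Fin (a k) ↪o Fin (s k)

/-- The order-preserving affine parametrization, by the simplex of `a`, of the face chosen
by `α`. -/
def face {m : ℕ} {a s : Exponent m} (α : FaceChoice a s) : Simplex a → Simplex s :=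
  stdSimplex.map (Sigma.map id fun k => α k)

/-- The identifications that define `X_g`: any two faces of the simplex that have, for every `k`,
the same number of vertices among `u_k¹, …, u_k^{j_k}`, are identified through the affine map that
preserves the order of the vertices of each kind. On the subsimplex with vertices
`u_k¹, …, u_k^{j_k}` this identifies, for every `ℓ`, all the `ℓ`-faces with one another; the
resulting space is the one attached to the power `u_k ^ j_k`. On the whole simplex, which is the
join of these subsimplices, it is the relation whose quotient is the join of these spaces. -/
inductive FaceRel {m : ℕ} (s : Exponent m) : Simplex s → Simplex s → Prop
  | ident {a : Exponent m} (α β : FaceChoice a s) (z : Simplex a) : FaceRel s (face α z) (face β z)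

/-- The complex `X_g` of the monomial `g` with exponent vector `s`: the simplex of `s` modulo the
equivalence relation generated by the identifications above, with the quotient topology. -/
def XSpace {m : ℕ} (s : Exponent m) : Type := Quot (FaceRel s)

instance {m : ℕ} (s : Exponent m) : TopologicalSpace (XSpace s) :=
  inferInstanceAs (TopologicalSpace (Quot (FaceRel s)))

/-- The face of the simplex of `s` on the first `a k` vertices of each kind. -/
def initialFace {m : ℕ} {a s : Exponent m} (h : a ≤ s) : FaceChoice a s :=
  fun k => Fin.castLEOrderEmb (h k)

theorem face_face {m : ℕ} {a b s : Exponent m} (α : FaceChoice a b) (β : FaceChoice b s)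
    (z : Simplex a) : face β (face α z) = face (fun k => (α k).trans (β k)) z := by
  unfold face
  rw [stdSimplex.map_comp_apply]
  rfl

/-- For `a ≤ s` the simplex of `a` is a face of the simplex of `s`; this is the induced map between
the quotients. (Every other face with the same number of vertices of each kind induces the same
map.) -/
def XSpace.incl {m : ℕ} {a s : Exponent m} (h : a ≤ s) : XSpace a → XSpace s :=
  Quot.map (face (initialFace h)) (by
    rintro _ _ ⟨α, β, z⟩
    rw [face_face, face_face]
    exact FaceRel.ident _ _ z)

/-- The gluing of the complexes: any two of them, `X_s` and `X_t`, are attached to each other along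
their common subcomplexes, the `X_c` with `c ≤ s` and `c ≤ t`. -/
inductive GlueRel (m : ℕ) : ((s : Exponent m) × XSpace s) → ((s : Exponent m) × XSpace s) → Prop
  | glue {c s t : Exponent m} (hs : c ≤ s) (ht : c ≤ t) (p : XSpace c) :
      GlueRel m ⟨s, XSpace.incl hs p⟩ ⟨t, XSpace.incl ht p⟩

/-- The space `P(m)`: the disjoint union of all the `X_g`, modulo the equivalence relation
generated by the gluing, with the quotient topology. -/
def PSpace (m : ℕ) : Type := Quot (GlueRel m)

instance (m : ℕ) : TopologicalSpace (PSpace m) :=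
  inferInstanceAs (TopologicalSpace (Quot (GlueRel m)))

/-- The canonical map from `X_g` to `P(m)`. -/
def XSpace.toP {m : ℕ} (s : Exponent m) (p : XSpace s) : PSpace m := Quot.mk _ ⟨s, p⟩

/-- `X_g` as a subset of `P(m)`. -/
def X {m : ℕ} (s : Exponent m) : Set (PSpace m) := Set.range (XSpace.toP s)

/-- The canonical map from the simplex of `s` to `P(m)`. -/
def simplexToP {m : ℕ} (s : Exponent m) (x : Simplex s) : PSpace m :=
  XSpace.toP s (Quot.mk _ x)

/-- The relative interior of the face with vertex set `F` of the simplex of `s`. -/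
def openFace {m : ℕ} (s : Exponent m) (F : Finset (Vertex s)) : Set (Simplex s) :=
  {x | ∀ w, 0 < x.1 w ↔ w ∈ F}

/-- The images in `P(m)` of the open `n`-dimensional faces of all the simplices from which `P(m)`
is built. -/
def openFaceImages (m n : ℕ) : Set (Set (PSpace m)) :=
  {U | ∃ (s : Exponent m) (F : Finset (Vertex s)),
    F.card = n + 1 ∧ U = simplexToP s '' openFace s F}

/-- The open `n`-cells of a CW-complex `Y`. -/
def openCells {Y : Type} [TopologicalSpace Y] (cw : CWComplex (Set.univ : Set Y)) (n : ℕ) :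
    Set (Set Y) :=
  {U | ∃ e : cw.cell n, U = RelCWComplex.openCell (C := (Set.univ : Set Y)) n e}

/-- The elements of the `n`-skeleton of a CW-complex `Y`: the closures of its `n`-cells. -/
def skeletonElements {Y : Type} [TopologicalSpace Y] (cw : CWComplex (Set.univ : Set Y)) (n : ℕ) :
    Set (Set Y) :=
  {Z | ∃ U ∈ openCells cw n, Z = closure U}

/-- The monic monomials of degree `d` in `K[u_1, …, u_m]`. -/
def monicMonomials (K : Type*) [Field K] (m d : ℕ) : Set (MvPolynomial (Fin m) K) :=
  {f | f.IsHomogeneous d ∧ ∃ s : Exponent m, f = MvPolynomial.monomial s 1}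

end MonomialCW

end

/-! Every point of a simplex lies in the interior of a unique face, so every point of `P(m)` is the
image of an interior point `z` of the simplex of some monomial `a`. This normal form `(a, z)` is
unique, and can be read off from continuous functions on `P(m)`: the identifications insert or
delete zeros in the sequences of barycentric coordinates at the vertices of each kind, and keep
the order of the nonzero ones. Monomial quasisymmetric polynomials `∑ x_{i_1} ^ e_1 ⋯ x_{i_r} ^ e_r`
over `i_1 < ⋯ < i_r`, with positive exponents, do not change when zeros are inserted, so they
descend to `P(m)` (`coordFun`). On a sequence of `n` positive numbers they vanish for `r > n` and
reduce to the single term `x_1 ^ e_1 ⋯ x_n ^ e_n` for `r = n`; comparing exponents all equal to `1`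
with those where one exponent is raised to `2` recovers the sequence (`eq_of_coordFun_eq`).

Hence `P(m)` is Hausdorff, and the maps from the compact spaces `X_g` are injective and therefore
embeddings (`isEmbedding_toP`). The interiors of the simplices inject into `P(m)` with disjoint
images, one for each nonconstant monomial; these are the open cells. Parametrizing simplices by balls
(`exists_closedBall_bijOn_stdSimplex`) gives the characteristic maps. The inverses are continuous by
compactness, the boundary of the cell of `g` meets only cells of proper divisors of `g`, and the
weak topology is the quotient topology (`cwComplex`). The closed cell of `g` is `X_g`, which is the
union of the open cells of the divisors of `g`; this gives both the bijection with the
monomials and the comparison of inclusion with divisibility. -/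

namespace MonomialCW

/-! ### Monomial quasisymmetric functions -/

/-- The monomial quasisymmetric polynomial in `n` variables whose exponents are `e 0 + 1`, …,
`e (r - 1) + 1`, evaluated at `x`. The shift makes all the exponents positive. -/
noncomputable def quasiMonomial {r n : ℕ} (e : Fin r → ℕ) (x : Fin n → ℝ) : ℝ :=
  ∑ i : Fin r ↪o Fin n, ∏ j, x (i j) ^ (e j + 1)

theorem continuous_quasiMonomial {r n : ℕ} (e : Fin r → ℕ) :
    Continuous (quasiMonomial e : (Fin n → ℝ) → ℝ) := by
  unfold quasiMonomial
  fun_prop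

/-- Inserting zeros between the variables does not change a quasisymmetric polynomial: a summand
that involves an inserted variable vanishes, because all the exponents are positive. -/
theorem quasiMonomial_comp_orderEmb {r p n : ℕ} (e : Fin r → ℕ) (α : Fin p ↪o Fin n)
    (x : Fin n → ℝ) (hx : ∀ i ∉ Set.range α, x i = 0) :
    quasiMonomial e (x ∘ α) = quasiMonomial e x := by
  refine Fintype.sum_of_injective (fun i : Fin r ↪o Fin p => i.trans α) ?_ _ _ ?_ (fun i => rfl)
  · intro i i' h
    ext j
    exact congrArg Fin.val (α.injective (DFunLike.congr_fun h j))
  · intro i hi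
    obtain ⟨j, hj⟩ : ∃ j, i j ∉ Set.range α := by
      by_contra! h
      choose q hq using h
      refine hi ⟨OrderEmbedding.ofStrictMono q fun a b hab => ?_, ?_⟩
      · rw [← α.lt_iff_lt, hq, hq]
        exact OrderEmbedding.strictMono i hab
      · ext j
        exact congrArg Fin.val (hq j)
    exact Finset.prod_eq_zero (Finset.mem_univ j) (by rw [hx _ hj, zero_pow (Nat.succ_ne_zero _)])

theorem quasiMonomial_eq_zero_of_lt {r n : ℕ} (h : n < r) (e : Fin r → ℕ) (x : Fin n → ℝ) :
    quasiMonomial e x = 0 := by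
  have : IsEmpty (Fin r ↪o Fin n) :=
    ⟨fun i => h.not_ge (by simpa using Fintype.card_le_of_injective i i.injective)⟩
  exact Fintype.sum_empty _

theorem quasiMonomial_eq_prod {n : ℕ} (e x) :
    quasiMonomial e x = ∏ j : Fin n, x j ^ (e j + 1) := by
  have h (i : Fin n ↪o Fin n) : i = RelEmbedding.refl _ := by
    ext j
    have hb : Function.Bijective i := Finite.injective_iff_bijective.1 i.injective
    have := Subsingleton.elim (RelIso.ofSurjective i hb.2) (OrderIso.refl _)
    exact congrArg Fin.val (DFunLike.congr_fun this j)
  rw [quasiMonomial, Fintype.sum_eq_single (RelEmbedding.refl _) fun i hi => (hi (h i)).elim]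
  rfl

theorem eq_of_quasiMonomial_eq {n : ℕ} {x y : Fin n → ℝ} (hx : ∀ i, 0 < x i)
    (h : ∀ e : Fin n → ℕ, quasiMonomial e x = quasiMonomial e y) : x = y := by
  funext i
  -- raising the exponent of one variable from `1` to `2` multiplies the polynomial by it
  have key (z : Fin n → ℝ) :
      quasiMonomial (Pi.single i 1) z = quasiMonomial (0 : Fin n → ℕ) z * z i := by
    simp only [quasiMonomial_eq_prod, pow_add, Finset.prod_mul_distrib]
    rw [mul_comm]
    simp [Finset.prod_eq_single i, Pi.single_apply]
  have h0 : 0 < quasiMonomial (0 : Fin n → ℕ) x := by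
    rw [quasiMonomial_eq_prod]
    exact Finset.prod_pos fun j _ => pow_pos (hx j) _
  have h1 := h (Pi.single i 1)
  rw [key, key, ← h 0] at h1
  exact mul_left_cancel₀ h0.ne' h1

/-! ### Faces of the simplices -/

variable {m : ℕ}

theorem face_apply {a s : Exponent m} (α : FaceChoice a s) (z : Simplex a) (k : Fin m)
    (i : Fin (a k)) : (face α z).1 ⟨k, α k i⟩ = z.1 ⟨k, i⟩ := by
  change FunOnFinite.linearMap ℝ ℝ _ _ _ = _
  rw [FunOnFinite.linearMap_apply_apply, Finset.sum_eq_single ⟨k, i⟩]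
  · rfl
  · rintro ⟨k', i'⟩ h hne
    obtain ⟨hk, h⟩ := Sigma.mk.inj_iff.1 (Finset.mem_filter.1 h).2
    dsimp only [id] at hk h
    subst hk
    exact (hne (congrArg _ ((α k').injective (eq_of_heq h)))).elim
  · intro h
    exact (h (Finset.mem_filter.2 ⟨Finset.mem_univ _, rfl⟩)).elim

theorem face_apply_eq_zero {a s : Exponent m} (α : FaceChoice a s) (z : Simplex a) (k : Fin m)
    {j : Fin (s k)} (hj : j ∉ Set.range (α k)) : (face α z).1 ⟨k, j⟩ = 0 := by
  change FunOnFinite.linearMap ℝ ℝ _ _ _ = _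
  rw [FunOnFinite.linearMap_apply_apply]
  refine Finset.sum_eq_zero ?_
  rintro ⟨k', i'⟩ h
  obtain ⟨rfl, h⟩ := Sigma.mk.inj_iff.1 (Finset.mem_filter.1 h).2
  exact (hj ⟨i', eq_of_heq h⟩).elim

theorem face_initialFace_le_rfl {a : Exponent m} (z : Simplex a) :
    face (initialFace le_rfl) z = z := by
  have : (Sigma.map id fun k => (initialFace (le_refl a) k : Fin (a k) → Fin (a k))) = id := rfl
  unfold face
  rw [this, stdSimplex.map_id_apply]

theorem FaceChoice.le {a s : Exponent m} (α : FaceChoice a s) : a ≤ s := fun k => by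
  simpa using Fintype.card_le_of_injective (α k) (α k).injective

theorem mem_openFace_univ {a : Exponent m} {z : Simplex a} :
    z ∈ openFace a Finset.univ ↔ ∀ v, 0 < z.1 v := by
  simp [openFace]

/-- The type of a set of vertices: the number of its elements of each kind. -/
noncomputable def faceType {s : Exponent m} (F : Finset (Vertex s)) : Exponent m :=
  Finsupp.equivFunOnFinite.symm fun k => (F.preimage (Sigma.mk k) sigma_mk_injective.injOn).card

theorem faceType_apply {s : Exponent m} (F : Finset (Vertex s)) (k : Fin m) :
    (F.preimage (Sigma.mk k) sigma_mk_injective.injOn).card = faceType F k := rfl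

/-- The face with vertex set `F`. -/
noncomputable def faceChoice {s : Exponent m} (F : Finset (Vertex s)) :
    FaceChoice (faceType F) s :=
  fun k => (F.preimage (Sigma.mk k) sigma_mk_injective.injOn).orderEmbOfFin (faceType_apply F k)

theorem mem_range_faceChoice {s : Exponent m} (F : Finset (Vertex s)) (k : Fin m)
    (j : Fin (s k)) : j ∈ Set.range (faceChoice F k) ↔ ⟨k, j⟩ ∈ F := by
  unfold faceChoice
  rw [Finset.range_orderEmbOfFin]
  simp

theorem degree_faceType {s : Exponent m} (F : Finset (Vertex s)) :
    (faceType F).degree = F.card := by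
  classical
  rw [Finsupp.degree_eq_sum, Finset.card_eq_sum_card_fiberwise (f := Sigma.fst) (t := Finset.univ)
    (fun _ _ => Finset.mem_coe.2 (Finset.mem_univ _))]
  refine Finset.sum_congr rfl fun k _ => ?_
  refine Finset.card_bij (fun j _ => ⟨k, j⟩) ?_
    (fun _ _ _ _ h => eq_of_heq (Sigma.mk.inj_iff.1 h).2) ?_
  · intro j hj
    simpa using hj
  · rintro ⟨k', j⟩ h
    obtain ⟨h, rfl⟩ := Finset.mem_filter.1 h
    exact ⟨j, by simpa using h, rfl⟩

theorem faceType_univ (a : Exponent m) : faceType (Finset.univ : Finset (Vertex a)) = a := by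
  ext k
  simp [faceType]

/-- An open face is parametrized by the interior of the simplex of its type. -/
theorem openFace_eq_image_face {s : Exponent m} (F : Finset (Vertex s)) :
    openFace s F = face (faceChoice F) '' openFace (faceType F) Finset.univ := by
  classical
  ext x
  constructor
  · intro hx
    have h0 (k : Fin m) (j : Fin (s k)) (hj : j ∉ Set.range (faceChoice F k)) :
        x.1 ⟨k, j⟩ = 0 := by
      rw [mem_range_faceChoice, ← hx] at hj
      exact le_antisymm (not_lt.1 hj) (x.2.1 _)
    let z : Simplex (faceType F) := ⟨fun v => x.1 ⟨v.1, faceChoice F v.1 v.2⟩, fun v => x.2.1 _, by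
      rw [← x.2.2, Fintype.sum_sigma, Fintype.sum_sigma]
      exact Finset.sum_congr rfl fun k _ => Fintype.sum_of_injective (faceChoice F k)
        (faceChoice F k).injective _ _ (h0 k) fun i => rfl⟩
    refine ⟨z, mem_openFace_univ.2 fun v => ?_, ?_⟩
    · exact (hx _).2 ((mem_range_faceChoice F _ _).1 ⟨_, rfl⟩)
    · refine Subtype.ext (funext ?_)
      rintro ⟨k, j⟩
      by_cases hj : j ∈ Set.range (faceChoice F k)
      · obtain ⟨i, rfl⟩ := hj
        exact face_apply _ _ _ _
      · rw [face_apply_eq_zero _ _ _ hj, h0 k j hj]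
  · rintro ⟨z, hz, rfl⟩ ⟨k, j⟩
    rw [mem_openFace_univ] at hz
    rw [← mem_range_faceChoice]
    constructor
    · intro h
      by_contra hj
      exact h.ne' (face_apply_eq_zero _ _ _ hj)
    · rintro ⟨i, rfl⟩
      rw [face_apply]
      exact hz _

theorem exists_eq_face {s : Exponent m} (x : Simplex s) :
    ∃ (a : Exponent m) (α : FaceChoice a s), ∃ z ∈ openFace a Finset.univ, face α z = x := by
  classical
  have hx : x ∈ openFace s (Finset.univ.filter fun v => 0 < x.1 v) := fun v => by simp
  rw [openFace_eq_image_face] at hx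
  exact ⟨_, _, hx⟩

/-! ### Points of the glued space -/

theorem continuous_toP (s : Exponent m) : Continuous (XSpace.toP s) :=
  continuous_quot_mk.comp continuous_sigmaMk

theorem continuous_simplexToP (s : Exponent m) : Continuous (simplexToP s) :=
  (continuous_toP s).comp continuous_quot_mk

theorem isClosed_iff_preimage_simplexToP {A : Set (PSpace m)} :
    IsClosed A ↔ ∀ s, IsClosed (simplexToP s ⁻¹' A) := by
  refine (isQuotientMap_quot_mk (r := GlueRel m)).isClosed_preimage.symm.trans ?_
  rw [isClosed_sigma_iff]
  exact forall_congr' fun s => (isQuotientMap_quot_mk.isClosed_preimage).symm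

theorem exists_simplexToP_eq (p : PSpace m) : ∃ s x, simplexToP s x = p := by
  induction p using Quot.ind with
  | mk p =>
    obtain ⟨s, q⟩ := p
    induction q using Quot.ind with
    | mk x => exact ⟨s, x, rfl⟩

/-- All the faces of a given type have the same image, that of the simplex of this type. -/
theorem simplexToP_face {a s : Exponent m} (α : FaceChoice a s) (z : Simplex a) :
    simplexToP s (face α z) = simplexToP a z := by
  have h1 : simplexToP s (face α z) = simplexToP s (face (initialFace α.le) z) :=
    congrArg (XSpace.toP s) (Quot.sound (FaceRel.ident α _ z))
  have h2 := Quot.sound (GlueRel.glue α.le (le_refl a) (Quot.mk _ z))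
  rw [h1]
  refine h2.trans ?_
  change simplexToP a (face (initialFace le_rfl) z) = _
  rw [face_initialFace_le_rfl]

/-- The quasisymmetric polynomials in the barycentric coordinates at the vertices of one kind, as
functions on the glued space. -/
noncomputable def coordFun (k : Fin m) {r : ℕ} (e : Fin r → ℕ) : PSpace m → ℝ :=
  Quot.lift (fun p => Quot.lift (fun x : Simplex p.1 => quasiMonomial e fun i => x.1 ⟨k, i⟩)
    (by
      rintro _ _ ⟨α, β, z⟩
      rw [← quasiMonomial_comp_orderEmb e (α k) _ fun j => face_apply_eq_zero α z k,
        ← quasiMonomial_comp_orderEmb e (β k) _ fun j => face_apply_eq_zero β z k]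
      congr 1
      funext i
      exact (face_apply α z k i).trans (face_apply β z k i).symm) p.2)
    (by
      rintro _ _ ⟨hs, ht, p⟩
      induction p using Quot.ind with
      | mk z =>
        change quasiMonomial e (fun i => (face (initialFace hs) z).1 ⟨k, i⟩) =
          quasiMonomial e (fun i => (face (initialFace ht) z).1 ⟨k, i⟩)
        rw [← quasiMonomial_comp_orderEmb e (initialFace hs k) _ fun j => face_apply_eq_zero _ z k,
          ← quasiMonomial_comp_orderEmb e (initialFace ht k) _ fun j => face_apply_eq_zero _ z k]
        congr 1
        funext i
        exact (face_apply _ z k i).trans (face_apply _ z k i).symm)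

theorem coordFun_simplexToP (k : Fin m) {r : ℕ} (e : Fin r → ℕ) {s : Exponent m} (x : Simplex s) :
    coordFun k e (simplexToP s x) = quasiMonomial e fun i => x.1 ⟨k, i⟩ := rfl

theorem continuous_coordFun (k : Fin m) {r : ℕ} (e : Fin r → ℕ) : Continuous (coordFun k e) := by
  refine isQuotientMap_quot_mk.continuous_iff.2 (continuous_sigma fun s => ?_)
  refine isQuotientMap_quot_mk.continuous_iff.2 ?_
  have h : Continuous fun (x : Simplex s) (i : Fin (s k)) => x.1 ⟨k, i⟩ :=
    continuous_pi fun i => (continuous_apply (⟨k, i⟩ : Vertex s)).comp continuous_subtype_val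
  exact (continuous_quasiMonomial e).comp h

/-- The functions `coordFun` determine both the face type and the barycentric coordinates of a
point given in normal form, that is, as an interior point of a simplex. -/
theorem eq_of_coordFun_eq {a b : Exponent m} {x : Simplex a} {y : Simplex b}
    (hx : x ∈ openFace a Finset.univ) (hy : y ∈ openFace b Finset.univ)
    (h : ∀ (k : Fin m) (r : ℕ) (e : Fin r → ℕ),
      coordFun k e (simplexToP a x) = coordFun k e (simplexToP b y)) :
    (⟨a, x⟩ : (s : Exponent m) × Simplex s) = ⟨b, y⟩ := by
  have key {a b : Exponent m} {x : Simplex a} {y : Simplex b} (hy : y ∈ openFace b Finset.univ)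
      (h : ∀ (k : Fin m) (r : ℕ) (e : Fin r → ℕ),
        coordFun k e (simplexToP a x) = coordFun k e (simplexToP b y)) : b ≤ a := by
    intro k
    by_contra! hk
    -- the product of the `b k` coordinates of `y` is positive, while `x` has fewer than `b k`
    have h1 := h k (b k) 0
    rw [coordFun_simplexToP, coordFun_simplexToP, quasiMonomial_eq_zero_of_lt hk,
      quasiMonomial_eq_prod] at h1
    exact (Finset.prod_pos fun j _ => pow_pos (mem_openFace_univ.1 hy _) _).ne h1
  -- once the types agree, the polynomials with as many variables as vertices give the coordinates
  obtain rfl : a = b := le_antisymm (key hx fun k r e => (h k r e).symm) (key hy h)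
  congr 1
  refine Subtype.ext (funext ?_)
  rintro ⟨k, i⟩
  exact congrFun (eq_of_quasiMonomial_eq (x := fun i => x.1 ⟨k, i⟩) (y := fun i => y.1 ⟨k, i⟩)
    (fun i => mem_openFace_univ.1 hx _) fun e => h k _ e) i

theorem eq_of_simplexToP_eq {a b : Exponent m} {x : Simplex a} {y : Simplex b}
    (hx : x ∈ openFace a Finset.univ) (hy : y ∈ openFace b Finset.univ)
    (h : simplexToP a x = simplexToP b y) :
    (⟨a, x⟩ : (s : Exponent m) × Simplex s) = ⟨b, y⟩ :=
  eq_of_coordFun_eq hx hy fun k r e => by rw [h]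

theorem exists_interior_eq {s : Exponent m} (x : Simplex s) :
    ∃ a ≤ s, ∃ z ∈ openFace a Finset.univ, simplexToP a z = simplexToP s x := by
  obtain ⟨a, α, z, hz, rfl⟩ := exists_eq_face x
  exact ⟨a, α.le, z, hz, (simplexToP_face α z).symm⟩

instance : T2Space (PSpace m) := by
  refine T2Space.of_injective_continuous
    (f := fun (p : PSpace m) (i : Fin m × (r : ℕ) × (Fin r → ℕ)) => coordFun i.1 i.2.2 p) ?_
    (continuous_pi fun i => continuous_coordFun i.1 i.2.2)
  intro p q h
  obtain ⟨s, x, rfl⟩ := exists_simplexToP_eq p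
  obtain ⟨t, y, rfl⟩ := exists_simplexToP_eq q
  obtain ⟨a, -, z, hz, hzx⟩ := exists_interior_eq x
  obtain ⟨b, -, w, hw, hwy⟩ := exists_interior_eq y
  rw [← hzx, ← hwy] at h ⊢
  have := eq_of_coordFun_eq hz hw fun k r e => congrFun h ⟨k, r, e⟩
  exact congrArg (fun c : (s : Exponent m) × Simplex s => simplexToP c.1 c.2) this

theorem injective_toP (s : Exponent m) : Function.Injective (XSpace.toP s) := by
  intro p q h
  induction p using Quot.ind with
  | mk x =>
    induction q using Quot.ind with
    | mk y =>
      obtain ⟨a, α, z, hz, rfl⟩ := exists_eq_face x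
      obtain ⟨b, β, w, hw, rfl⟩ := exists_eq_face y
      change simplexToP s (face α z) = simplexToP s (face β w) at h
      rw [simplexToP_face, simplexToP_face] at h
      obtain ⟨rfl, h⟩ := Sigma.mk.inj_iff.1 (eq_of_simplexToP_eq hz hw h)
      rw [← eq_of_heq h]
      exact Quot.sound (FaceRel.ident α β z)

theorem isEmbedding_toP (s : Exponent m) : IsEmbedding (XSpace.toP s) := by
  have : CompactSpace (XSpace s) := inferInstanceAs (CompactSpace (Quot (FaceRel s)))
  exact ((continuous_toP s).isClosedEmbedding (injective_toP s)).isEmbedding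

/-! ### A simplex as a closed ball -/

open Metric Set in
/-- A simplex of dimension `n` is a closed ball, and its interior is the open ball. The ball lies
in `Fin n → ℝ` with the maximum norm, as the definition of a CW-complex requires; the map is
defined on the whole space, with arbitrary values outside the ball. -/
theorem exists_closedBall_bijOn_stdSimplex (ι : Type*) [Fintype ι] (n : ℕ)
    (h : Fintype.card ι = n + 1) :
    ∃ f : (Fin n → ℝ) → stdSimplex ℝ ι, ContinuousOn f (closedBall 0 1) ∧
      BijOn f (closedBall 0 1) univ ∧ ∀ x ∈ closedBall 0 1, x ∈ ball 0 1 ↔ ∀ i, 0 < (f x).1 i := by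
  classical
  let e : ι ≃ Fin (n + 1) := Fintype.equivFinOfCardEq h
  -- the barycentric coordinates, and the simplex that they cut out in `Fin n → ℝ`
  let ψ : (Fin n → ℝ) → ι → ℝ := fun y v => (Fin.cons (1 - ∑ i, y i) y : Fin (n + 1) → ℝ) (e v)
  let S : Set (Fin n → ℝ) := {y | ∀ v, 0 ≤ ψ y v}
  let T : Set (Fin n → ℝ) := {y | ∀ v, 0 < ψ y v}
  have hψ : Continuous ψ := by
    refine continuous_pi fun v => ?_
    change Continuous fun y : Fin n → ℝ => (Fin.cons (1 - ∑ i, y i) y : Fin (n + 1) → ℝ) (e v)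
    refine Fin.cases ?_ (fun i => ?_) (e v) <;> simp only [Fin.cons_zero, Fin.cons_succ] <;> fun_prop
  have hψinj : Function.Injective ψ := fun y y' hy => by
    funext i
    simpa [ψ] using congrFun hy (e.symm i.succ)
  have hψsum (y) : ∑ v, ψ y v = 1 := by
    rw [e.sum_comp (Fin.cons (1 - ∑ i, y i) y : Fin (n + 1) → ℝ), Fin.sum_univ_succ]
    simp
  have hψline (y b : Fin n → ℝ) (t : ℝ) (v : ι) :
      ψ (y + t • (b - y)) v = ψ y v + t * (ψ b v - ψ y v) := by
    simp only [ψ]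
    refine Fin.cases ?_ (fun i => ?_) (e v)
    · simp only [Fin.cons_zero, Pi.add_apply, Pi.smul_apply, Pi.sub_apply, smul_eq_mul,
        Finset.sum_add_distrib, ← Finset.mul_sum, Finset.sum_sub_distrib]
      ring
    · simp
  have hSmem (y) (hy : y ∈ S) : ψ y ∈ stdSimplex ℝ ι := ⟨hy, hψsum y⟩
  have hψsurj (x : stdSimplex ℝ ι) : ∃ y ∈ S, ψ y = x.1 := by
    have hx : ψ (fun i => x.1 (e.symm i.succ)) = x.1 := by
      funext v
      obtain ⟨j, rfl⟩ := e.symm.surjective v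
      have := x.2.2
      rw [← e.symm.sum_comp, Fin.sum_univ_succ] at this
      simp only [ψ, Equiv.apply_symm_apply]
      refine Fin.cases ?_ (fun i => ?_) j
      · rw [Fin.cons_zero, ← this]
        ring
      · rw [Fin.cons_succ]
    exact ⟨_, fun v => by rw [hx]; exact x.2.1 v, hx⟩
  have hSclosed : IsClosed S := by
    simp only [S, ofPred_forall]
    exact isClosed_iInter fun v => isClosed_le continuous_const ((continuous_apply v).comp hψ)
  have hTopen : IsOpen T := by
    simp only [T, ofPred_forall]
    exact isOpen_iInter_of_finite fun v => isOpen_lt continuous_const ((continuous_apply v).comp hψ)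
  have hTS : T ⊆ S := fun y hy v => (hy v).le
  obtain ⟨b, hb⟩ : T.Nonempty := by
    have : Nonempty ι := ⟨e.symm 0⟩
    obtain ⟨y, -, hy⟩ := hψsurj stdSimplex.barycenter
    exact ⟨y, fun v => by rw [hy, stdSimplex.barycenter_apply]; simp [h]; positivity⟩
  have hST : interior S = T := by
    refine Subset.antisymm (fun y hy v => ?_) (interior_maximal hTS hTopen)
    -- move from `y` slightly further away from the interior point `b`
    have hcont : Continuous fun t : ℝ => y + t • (b - y) := by fun_prop
    have h0 : ∀ᶠ t in 𝓝 (0 : ℝ), y + t • (b - y) ∈ S := by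
      refine hcont.continuousAt.eventually_mem ?_
      simpa using mem_interior_iff_mem_nhds.1 hy
    obtain ⟨t, ht, ht0⟩ := ((h0.filter_mono nhdsWithin_le_nhds).and
      (self_mem_nhdsWithin : Iio (0 : ℝ) ∈ 𝓝[<] 0)).exists
    have h1 := ht v
    rw [hψline] at h1
    have h2 : t * ψ b v < 0 := mul_neg_of_neg_of_pos ht0 (hb v)
    have h3 : t < 0 := ht0
    nlinarith
  have hconv : Convex ℝ S := by
    intro y hy z hz p q hp hq hpq v
    have : p • y + q • z = y + q • (z - y) := by
      rw [← eq_sub_iff_add_eq] at hpq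
      rw [hpq]; module
    rw [this, hψline, show ψ y v + q * (ψ z v - ψ y v) = p * ψ y v + q * ψ z v by
      rw [← eq_sub_iff_add_eq] at hpq; rw [hpq]; ring]
    exact add_nonneg (mul_nonneg hp (hy v)) (mul_nonneg hq (hz v))
  have hbdd : Bornology.IsBounded S := by
    refine isBounded_closedBall (x := (0 : Fin n → ℝ)) (r := 1) |>.subset fun y hy => ?_
    rw [mem_closedBall_zero_iff, pi_norm_le_iff_of_nonneg zero_le_one]
    intro i
    have := mem_Icc_of_mem_stdSimplex (hSmem y hy) (e.symm i.succ)
    simp only [ψ, Equiv.apply_symm_apply, Fin.cons_succ] at this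
    rw [Real.norm_of_nonneg this.1]
    exact this.2
  obtain ⟨g, hg1, hg2, -⟩ := exists_homeomorph_image_interior_closure_frontier_eq_unitBall hconv
    ⟨b, hST ▸ hb⟩ hbdd
  rw [hST] at hg1
  rw [hSclosed.closure_eq] at hg2
  have hgS (x) : x ∈ closedBall 0 1 ↔ g.symm x ∈ S := by
    rw [← hg2]
    exact ⟨by rintro ⟨y, hy, rfl⟩; simpa using hy, fun h => ⟨_, h, by simp⟩⟩
  have hgT (x) : x ∈ ball 0 1 ↔ g.symm x ∈ T := by
    rw [← hg1]
    exact ⟨by rintro ⟨y, hy, rfl⟩; simpa using hy, fun h => ⟨_, h, by simp⟩⟩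
  let f : (Fin n → ℝ) → stdSimplex ℝ ι := fun x =>
    if hx : g.symm x ∈ S then ⟨ψ (g.symm x), hSmem _ hx⟩ else ⟨ψ b, hSmem _ (hTS hb)⟩
  have hf (x) (hx : x ∈ closedBall 0 1) : (f x).1 = ψ (g.symm x) := by
    simp only [f, dif_pos ((hgS x).1 hx)]
  refine ⟨f, ?_, ⟨fun _ _ => mem_univ _, fun x hx y hy hxy => ?_, fun z _ => ?_⟩, fun x hx => ?_⟩
  · rw [IsInducing.subtypeVal.continuousOn_iff]
    exact (hψ.comp g.symm.continuous).continuousOn.congr fun x hx => hf x hx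
  · have := congrArg Subtype.val hxy
    rw [hf x hx, hf y hy] at this
    exact g.symm.injective (hψinj this)
  · obtain ⟨y, hy, hyz⟩ := hψsurj z
    have hy' : g y ∈ closedBall 0 1 := (hgS _).2 (by simpa using hy)
    refine ⟨g y, hy', Subtype.ext ?_⟩
    rw [hf _ hy', g.symm_apply_apply, hyz]
  · rw [hgT, hf x hx]
    rfl

/-! ### The cell structure -/

/-- The open cell of a monomial: the image of the interior of its simplex. -/
def interiorCell (a : Exponent m) : Set (PSpace m) := simplexToP a '' openFace a Finset.univ

theorem X_eq_range (a : Exponent m) : X a = Set.range (simplexToP a) :=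
  (Quot.mk_surjective.range_comp (XSpace.toP a)).symm

theorem interiorCell_subset_X (a : Exponent m) : interiorCell a ⊆ X a := by
  rw [X_eq_range]
  exact Set.image_subset_range _ _

theorem image_openFace_eq_interiorCell {s : Exponent m} (F : Finset (Vertex s)) :
    simplexToP s '' openFace s F = interiorCell (faceType F) := by
  rw [openFace_eq_image_face, Set.image_image, interiorCell]
  simp only [simplexToP_face]

theorem interiorCell_disjoint {a b : Exponent m} {p : PSpace m} (ha : p ∈ interiorCell a)
    (hb : p ∈ interiorCell b) : a = b := by
  obtain ⟨x, hx, rfl⟩ := ha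
  obtain ⟨y, hy, h⟩ := hb
  exact (Sigma.mk.inj_iff.1 (eq_of_simplexToP_eq hx hy h.symm)).1

theorem injOn_simplexToP (a : Exponent m) :
    Set.InjOn (simplexToP a) (openFace a Finset.univ) := fun _ hx _ hy h =>
  eq_of_heq (Sigma.mk.inj_iff.1 (eq_of_simplexToP_eq hx hy h)).2

theorem exists_mem_interiorCell {a : Exponent m} (x : Simplex a) :
    ∃ b ≤ a, simplexToP a x ∈ interiorCell b := by
  obtain ⟨b, hb, z, hz, h⟩ := exists_interior_eq x
  exact ⟨b, hb, z, hz, h⟩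

theorem mem_interiorCell_iff {a : Exponent m} {x : Simplex a} :
    simplexToP a x ∈ interiorCell a ↔ x ∈ openFace a Finset.univ := by
  classical
  refine ⟨fun h => ?_, fun h => ⟨x, h, rfl⟩⟩
  have hx : x ∈ openFace a (Finset.univ.filter fun v => 0 < x.1 v) := fun v => by simp
  have h' := Set.mem_image_of_mem (simplexToP a) hx
  rw [image_openFace_eq_interiorCell] at h'
  -- the face that contains `x` in its interior has as many vertices as the whole simplex
  have hd := congrArg Finsupp.degree (interiorCell_disjoint h' h)
  conv_rhs at hd => rw [← faceType_univ a]
  rw [degree_faceType, degree_faceType, Finset.card_univ] at hd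
  rwa [(Finset.card_eq_iff_eq_univ _).1 hd] at hx

theorem card_vertex (a : Exponent m) : Fintype.card (Vertex a) = a.degree := by
  rw [← Finset.card_univ, ← degree_faceType, faceType_univ]

theorem degree_ne_zero_of_mem {a : Exponent m} {p : PSpace m} (hp : p ∈ X a) : a.degree ≠ 0 := by
  rw [X_eq_range] at hp
  obtain ⟨x, rfl⟩ := hp
  intro h
  have : IsEmpty (Vertex a) := Fintype.card_eq_zero_iff.1 ((card_vertex a).trans h)
  have := x.2.2
  simp at this

theorem interiorCell_nonempty {a : Exponent m} (h : a ≠ 0) : (interiorCell a).Nonempty := by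
  have : Nonempty (Vertex a) := by
    by_contra hn
    rw [not_nonempty_iff] at hn
    have h1 := card_vertex a
    rw [Fintype.card_eq_zero] at h1
    exact h ((Finsupp.degree_eq_zero_iff _).1 h1.symm)
  refine ⟨_, stdSimplex.barycenter, mem_openFace_univ.2 fun v => ?_, rfl⟩
  rw [stdSimplex.barycenter_apply]
  positivity

theorem X_subset_X_iff {s t : Exponent m} : X s ⊆ X t ↔ s ≤ t := by
  constructor
  · intro h
    by_cases hs : s = 0
    · rw [hs]
      exact zero_le
    obtain ⟨p, hp⟩ := interiorCell_nonempty hs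
    have hpt := h (interiorCell_subset_X s hp)
    rw [X_eq_range] at hpt
    obtain ⟨y, rfl⟩ := hpt
    obtain ⟨b, hb, hyb⟩ := exists_mem_interiorCell y
    rwa [interiorCell_disjoint hp hyb]
  · intro h
    rw [X_eq_range, X_eq_range]
    rintro _ ⟨x, rfl⟩
    exact ⟨face (initialFace h) x, simplexToP_face _ x⟩

/-- The parameters of the `n`-cells: the monomials of degree `n + 1`. -/
abbrev CellIndex (m n : ℕ) : Type := {a : Exponent m // a.degree = n + 1}

/-- The ball as a parametrization of the simplex of a monomial. -/
noncomputable def ballParam {n : ℕ} (a : CellIndex m n) : (Fin n → ℝ) → Simplex a.1 :=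
  (exists_closedBall_bijOn_stdSimplex (Vertex a.1) n ((card_vertex a.1).trans a.2)).choose

open Metric Set

theorem ballParam_spec {n : ℕ} (a : CellIndex m n) :
    ContinuousOn (ballParam a) (closedBall 0 1) ∧ BijOn (ballParam a) (closedBall 0 1) univ ∧
      ∀ x ∈ closedBall 0 1, x ∈ ball 0 1 ↔ ∀ i, 0 < (ballParam a x).1 i :=
  (exists_closedBall_bijOn_stdSimplex (Vertex a.1) n ((card_vertex a.1).trans a.2)).choose_spec

/-- The characteristic map of the cell of a monomial. -/
noncomputable def charMap {n : ℕ} (a : CellIndex m n) (x : Fin n → ℝ) : PSpace m :=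
  simplexToP a.1 (ballParam a x)

theorem continuousOn_charMap {n : ℕ} (a : CellIndex m n) :
    ContinuousOn (charMap a) (closedBall 0 1) :=
  (continuous_simplexToP a.1).comp_continuousOn (ballParam_spec a).1

theorem charMap_mem_interiorCell {n : ℕ} (a : CellIndex m n) {x : Fin n → ℝ}
    (hx : x ∈ closedBall 0 1) : charMap a x ∈ interiorCell a.1 ↔ x ∈ ball 0 1 := by
  rw [charMap, mem_interiorCell_iff, mem_openFace_univ, (ballParam_spec a).2.2 x hx]

theorem image_closedBall_charMap {n : ℕ} (a : CellIndex m n) :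
    charMap a '' closedBall 0 1 = X a.1 := by
  rw [X_eq_range, ← image_univ, ← (ballParam_spec a).2.1.image_eq, image_image]
  rfl

theorem image_ball_charMap {n : ℕ} (a : CellIndex m n) :
    charMap a '' ball 0 1 = interiorCell a.1 := by
  apply Subset.antisymm
  · rintro _ ⟨x, hx, rfl⟩
    exact (charMap_mem_interiorCell a (ball_subset_closedBall hx)).2 hx
  · intro p hp
    have hpX := interiorCell_subset_X a.1 hp
    rw [← image_closedBall_charMap] at hpX
    obtain ⟨x, hx, rfl⟩ := hpX
    exact ⟨x, (charMap_mem_interiorCell a hx).1 hp, rfl⟩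

theorem injOn_charMap {n : ℕ} (a : CellIndex m n) : InjOn (charMap a) (ball 0 1) := by
  have h (x : Fin n → ℝ) (hx : x ∈ ball 0 1) : ballParam a x ∈ openFace a.1 Finset.univ :=
    mem_openFace_univ.2 (((ballParam_spec a).2.2 x (ball_subset_closedBall hx)).1 hx)
  intro x hx y hy hxy
  exact (ballParam_spec a).2.1.injOn (ball_subset_closedBall hx) (ball_subset_closedBall hy)
    (injOn_simplexToP a.1 (h x hx) (h y hy) hxy)

/-- A continuous map from a compact set `K` to a Hausdorff space that is injective on `B ⊆ K` has a
continuous inverse on the image of `B`, if this image meets no other points of `K`. -/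
theorem continuousOn_toPartialEquiv_symm {E Y : Type*} [TopologicalSpace E] [TopologicalSpace Y]
    [T2Space Y] [Nonempty E] {f : E → Y} {K B : Set E} (hK : IsCompact K) (hBK : B ⊆ K)
    (hf : ContinuousOn f K) (hB : InjOn f B) (hsat : ∀ x ∈ K, f x ∈ f '' B → x ∈ B) :
    ContinuousOn (hB.toPartialEquiv f B).symm (f '' B) := by
  rw [continuousOn_iff_isClosed]
  intro t ht
  refine ⟨f '' (K ∩ t), ((hK.inter_right ht).image_of_continuousOn
    (hf.mono inter_subset_left)).isClosed, ?_⟩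
  have hinv (x) (hx : x ∈ B) : (hB.toPartialEquiv f B).symm (f x) = x :=
    (hB.toPartialEquiv f B).left_inv hx
  ext p
  constructor
  · rintro ⟨hp, x, hx, rfl⟩
    rw [mem_preimage, hinv x hx] at hp
    exact ⟨⟨x, ⟨hBK hx, hp⟩, rfl⟩, x, hx, rfl⟩
  · rintro ⟨⟨x, ⟨hxK, hxt⟩, rfl⟩, hp⟩
    refine ⟨?_, hp⟩
    rw [mem_preimage, hinv x (hsat x hxK hp)]
    exact hxt

theorem exists_cellIndex_of_mem {a : Exponent m} {p : PSpace m} (hp : p ∈ X a) :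
    ∃ n, a.degree = n + 1 :=
  Nat.exists_eq_succ_of_ne_zero (degree_ne_zero_of_mem hp)

/-- The boundary of a cell lies in the union of the cells of the proper divisors. -/
theorem exists_lt_of_mem_sphere {n : ℕ} (a : CellIndex m n) {x : Fin n → ℝ}
    (hx : x ∈ sphere 0 1) : ∃ k < n, ∃ b : CellIndex m k, b.1 ≤ a.1 ∧ charMap a x ∈ X b.1 := by
  obtain ⟨b, hb, hxb⟩ := exists_mem_interiorCell (ballParam a x)
  have hbX := interiorCell_subset_X b hxb
  have hne : b ≠ a.1 := by
    rintro rfl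
    have := (charMap_mem_interiorCell a (sphere_subset_closedBall hx)).1 hxb
    exact (mem_ball.1 this).ne (mem_sphere.1 hx)
  obtain ⟨k, hk⟩ := exists_cellIndex_of_mem hbX
  refine ⟨k, ?_, ⟨b, hk⟩, hb, hbX⟩
  obtain ⟨c, hc⟩ := exists_add_of_le hb
  have hc0 : c.degree ≠ 0 := fun h => hne (by
    rw [hc, (Finsupp.degree_eq_zero_iff _).1 h, add_zero])
  have := congrArg Finsupp.degree hc
  rw [map_add, hk, a.2] at this
  omega

/-- The cell structure whose `n`-cells are indexed by the monomials of degree `n + 1`. -/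
noncomputable abbrev cwComplex (m : ℕ) : CWComplex (univ : Set (PSpace m)) where
  cell n := CellIndex m n
  map n a := (injOn_charMap a).toPartialEquiv (charMap a) (ball 0 1)
  source_eq n a := rfl
  continuousOn n a := continuousOn_charMap a
  continuousOn_symm n a := by
    refine continuousOn_toPartialEquiv_symm (isCompact_closedBall 0 1) ball_subset_closedBall
      (continuousOn_charMap a) (injOn_charMap a) fun x hx h => ?_
    rwa [image_ball_charMap, charMap_mem_interiorCell a hx] at h
  pairwiseDisjoint' := by
    rintro ⟨n, a⟩ - ⟨n', b⟩ - hne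
    change Disjoint (charMap a '' ball 0 1) (charMap b '' ball 0 1)
    rw [image_ball_charMap, image_ball_charMap, disjoint_left]
    intro p ha hb
    obtain ⟨a, ha'⟩ := a
    obtain ⟨b, hb'⟩ := b
    obtain rfl : a = b := interiorCell_disjoint ha hb
    obtain rfl : n = n' := by omega
    exact hne rfl
  mapsTo' n a := by
    have hfin (k : ℕ) : {b : CellIndex m k | b.1 ≤ a.1}.Finite :=
      (finite_Iic a.1).preimage Subtype.val_injective.injOn
    refine ⟨fun k => (hfin k).toFinset, fun x hx => ?_⟩
    obtain ⟨k, hk, b, hb, hxb⟩ := exists_lt_of_mem_sphere a hx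
    rw [← image_closedBall_charMap] at hxb
    simp only [mem_iUnion]
    exact ⟨k, hk, b, (hfin k).mem_toFinset.2 hb, hxb⟩
  closed' A _ hA := by
    rw [isClosed_iff_preimage_simplexToP]
    intro s
    rcases isEmpty_or_nonempty (Simplex s) with hs | ⟨⟨x⟩⟩
    · rw [Subsingleton.elim (simplexToP s ⁻¹' A) ∅]
      exact isClosed_empty
    obtain ⟨n, hn⟩ := exists_cellIndex_of_mem (mem_range_self (f := XSpace.toP s) (Quot.mk _ x))
    have h : IsClosed (A ∩ charMap ⟨s, hn⟩ '' closedBall 0 1) := hA n ⟨s, hn⟩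
    rw [image_closedBall_charMap, X_eq_range] at h
    have h' := h.preimage (continuous_simplexToP s)
    rwa [preimage_inter, preimage_range, inter_univ] at h'
  union' := by
    refine eq_univ_of_forall fun p => ?_
    obtain ⟨s, x, rfl⟩ := exists_simplexToP_eq p
    have hx : simplexToP s x ∈ X s := mem_range_self (f := XSpace.toP s) (Quot.mk _ x)
    obtain ⟨n, hn⟩ := exists_cellIndex_of_mem hx
    simp only [mem_iUnion]
    refine ⟨n, ⟨s, hn⟩, ?_⟩
    change _ ∈ charMap ⟨s, hn⟩ '' closedBall 0 1
    rwa [image_closedBall_charMap]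

theorem openCells_cwComplex (m n : ℕ) :
    openCells (cwComplex m) n = {U | ∃ a : CellIndex m n, U = interiorCell a.1} := by
  ext U
  exact exists_congr fun a => by rw [← image_ball_charMap a]; rfl

theorem openCells_cwComplex_eq_openFaceImages (m n : ℕ) :
    openCells (cwComplex m) n = openFaceImages m n := by
  rw [openCells_cwComplex]
  ext U
  constructor
  · rintro ⟨a, rfl⟩
    exact ⟨a.1, Finset.univ, (card_vertex a.1).trans a.2, rfl⟩
  · rintro ⟨s, F, hF, rfl⟩
    exact ⟨⟨faceType F, (degree_faceType F).trans hF⟩, image_openFace_eq_interiorCell F⟩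

theorem closure_interiorCell {n : ℕ} (a : CellIndex m n) : closure (interiorCell a.1) = X a.1 := by
  let := cwComplex m
  have h := RelCWComplex.closure_openCell_eq_closedCell (C := (univ : Set (PSpace m))) (n := n)
    (j := a)
  change closure (charMap a '' ball 0 1) = charMap a '' closedBall 0 1 at h
  rwa [image_ball_charMap, image_closedBall_charMap] at h

theorem skeletonElements_cwComplex (m n : ℕ) :
    skeletonElements (cwComplex m) n = {Z | ∃ a : CellIndex m n, Z = X a.1} := by
  rw [skeletonElements, openCells_cwComplex]
  ext Z
  constructor
  · rintro ⟨_, ⟨a, rfl⟩, rfl⟩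
    exact ⟨a, closure_interiorCell a⟩
  · rintro ⟨a, rfl⟩
    exact ⟨_, ⟨a, rfl⟩, (closure_interiorCell a).symm⟩

theorem X_injective : Function.Injective (X : Exponent m → Set (PSpace m)) := fun _ _ h =>
  le_antisymm (X_subset_X_iff.1 h.le) (X_subset_X_iff.1 h.ge)

/-! ### The correspondence with monomials -/

/-- The monic monomials of degree `d` and the exponent vectors of degree `d`. -/
noncomputable def exponentEquivMonicMonomials (K : Type*) [Field K] (m d : ℕ) :
    {a : Exponent m // a.degree = d} ≃ monicMonomials K m d :=
  Equiv.ofBijective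
    (fun a => ⟨MvPolynomial.monomial a.1 1, MvPolynomial.isHomogeneous_monomial 1 a.2, a.1, rfl⟩) (by
      constructor
      · intro a b h
        exact Subtype.ext (MvPolynomial.monomial_left_injective one_ne_zero
          (congrArg Subtype.val h))
      · rintro ⟨_, hd, s, rfl⟩
        refine ⟨⟨s, ?_⟩, rfl⟩
        rw [Finsupp.degree_eq_weight_one]
        exact hd (by simp))

/-- The exponent vectors of degree `n + 1` and the closed `n`-cells. -/
noncomputable def exponentEquivSkeletonElements (m n : ℕ) :
    CellIndex m n ≃ skeletonElements (cwComplex m) n :=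
  Equiv.ofBijective
    (fun a => ⟨X a.1, by rw [skeletonElements_cwComplex]; exact ⟨a, rfl⟩⟩) (by
      constructor
      · intro a b h
        exact Subtype.ext (X_injective (congrArg Subtype.val h))
      · rintro ⟨Z, hZ⟩
        obtain ⟨a, rfl⟩ := (skeletonElements_cwComplex m n).subset hZ
        exact ⟨a, rfl⟩)

end MonomialCW

theorem proposition3 (K : Type*) [Field K] (m : ℕ) :
    T2Space (MonomialCW.PSpace m) ∧
    (∀ s : MonomialCW.Exponent m, IsEmbedding (MonomialCW.XSpace.toP s)) ∧
    (∃ cw : CWComplex (Set.univ : Set (MonomialCW.PSpace m)),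
      (∀ n : ℕ, MonomialCW.openCells cw n = MonomialCW.openFaceImages m n) ∧
      (∀ n : ℕ,
        ∃ σ : MonomialCW.monicMonomials K m (n + 1) ≃ MonomialCW.skeletonElements cw n,
          ∀ (g : MonomialCW.monicMonomials K m (n + 1)) (s : MonomialCW.Exponent m),
            (g : MvPolynomial (Fin m) K) = MvPolynomial.monomial s 1 →
              (σ g : Set (MonomialCW.PSpace m)) = MonomialCW.X s)) ∧
    (∀ s t : MonomialCW.Exponent m,
      MonomialCW.X s ⊆ MonomialCW.X t ↔
        (MvPolynomial.monomial s (1 : K)) ∣ MvPolynomial.monomial t (1 : K)) := by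
  refine ⟨inferInstance, MonomialCW.isEmbedding_toP, ⟨MonomialCW.cwComplex m,
    MonomialCW.openCells_cwComplex_eq_openFaceImages m, fun n => ?_⟩, fun s t => ?_⟩
  · refine ⟨(MonomialCW.exponentEquivMonicMonomials K m (n + 1)).symm.trans
      (MonomialCW.exponentEquivSkeletonElements m n), fun g s hg => ?_⟩
    obtain ⟨a, rfl⟩ := (MonomialCW.exponentEquivMonicMonomials K m (n + 1)).surjective g
    rw [Equiv.trans_apply, Equiv.symm_apply_apply,
      ← MvPolynomial.monomial_left_injective one_ne_zero hg]
    rfl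
  · rw [MonomialCW.X_subset_X_iff, MvPolynomial.monomial_dvd_monomial]
    simp
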